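/- Let $\mathbb{F}$ be a field and let $(f_n)_{n\in\mathbb{N}}$ be a family of polynomials over $\mathbb{F}$ in the variables $X_1, X_2, \ldots$. Then $(f_n)\in\mathsf{VP}$ if and only if $(f_n)$ is computed by a family of stack branching programs of polynomial size, i.e. there are stack branching programs $G_n$ with $f_{G_n}=f_n$ for all $n$ and a univariate polynomial $p$ such that $G_n$ has at most $p(n)$ vertices for all $n$. Here the notions are as follows. An \emph{arithmetic circuit} over $\mathbb{F}$ is a finite directed acyclic graph of gates of fan-in $0$ or $2$ with exactly one sink, the output gate; the gates of fan-in $0$ are labeled with elements of $\mathbb{F}\cup\{X_1,X_2,\ldots\}$ and compute their label, the gates of fan-in $2$ are labeled with $+$ or $\times$ and compute the sum or product of the polynomials computed by their two children (which may coincide). The circuit computes the polynomial of its output gate, and its size is the number of gates. $\mathsf{VP}$ is the class of families $(f_n)$ for which there is a univariate polynomial $p$ with $\deg(f_n)\le p(n)$ for all $n$, and which are computed by a family of arithmetic circuits $(C_n)$ whose sizes are bounded by a polynomial in $n$. Let $S$ be a set of symbols. The \emph{stack operations} on $S$ are $\mathrm{push}(s)$ and $\mathrm{pop}(s)$ for $s\in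 S$, and $\mathrm{nop}$. The \emph{realizable} sequences of stack operations form the smallest set that contains the empty sequence and that contains, for all realizable $P$ and $Q$ and all $s\in S$, the sequences $\mathrm{push}(s)\,P\,\mathrm{pop}(s)$, $\mathrm{nop}\,P$, $P\,\mathrm{nop}$ and $PQ$. A \emph{stack branching program} $G$ consists of a finite directed acyclic graph $(V,E)$ with $E\subseteq V\times V$, vertices $s,t\in V$, a symbol set $S$, an edge labeling $w:E\to\mathbb{F}\cup\{X_1,X_2,\ldots\}$, and a labeling $\sigma$ of the edges by stack operations on $S$. A path $v_1v_2\ldots v_r$ is \emph{stack-realizable} if the sequence $\sigma(v_1v_2)\sigma(v_2v_3)\ldots\sigma(v_{r-1}v_r)$ is realizable, and its weight is $w(v_1\ldots v_r)=\prod_{i=1}^{r-1}w(v_iv_{i+1})$. The program $G$ computes the polynomial $f_G=\sum_P w(P)$, where the sum is over all stack-realizable paths $P$ from $s$ to $t$, and its size is $|V|$. -/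

import Mathlib

noncomputable section

/-- The labels of input gates and of edges: a constant of `F` or one of the variables
`X_i` (indexed by `ℕ`). -/
inductive Label (F : Type*) where
  | const : F → Label F
  | var : ℕ → Label F

/-- A label as a polynomial. -/
def Label.toPoly {F : Type*} [Field F] : Label F → MvPolynomial ℕ F
  | .const c => MvPolynomial.C c
  | .var i => MvPolynomial.X i

/-! ### Arithmetic circuits -/

/-- A gate over the vertex set `V`: an input gate (fan-in 0) with its label, or a computation gate
(fan-in 2) with its two children. -/
inductive Gate (F : Type*) (V : Type) where
  | input : Label F → Gate F V
  | add : V → V → Gate F V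
  | mul : V → V → Gate F V

/-- `g.HasChild u`: the vertex `u` is a child of the gate `g`. -/
def Gate.HasChild {F : Type*} {V : Type} : Gate F V → V → Prop
  | .input _, _ => False
  | .add a b, u => u = a ∨ u = b
  | .mul a b, u => u = a ∨ u = b

/-- An arithmetic circuit over `F`: a finite directed acyclic graph of gates with exactly one
sink, the output gate `out`. -/
structure Circuit (F : Type*) where
  V : Type
  [fintypeV : Fintype V]
  gate : V → Gate F V
  acyclic : ∀ v, ¬ Relation.TransGen (fun u v => (gate v).HasChild u) v v
  out : V
  isSink_iff : ∀ v, (¬ ∃ u, (gate u).HasChild v) ↔ v = out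

attribute [instance] Circuit.fintypeV

namespace Circuit

variable {F : Type*} (C : Circuit F)

/-- The number of gates. -/
def size : ℕ := Fintype.card C.V

/-- `C.IsChild u v`: the gate `u` is a child of the gate `v`. -/
def IsChild (u v : C.V) : Prop := (C.gate v).HasChild u

theorem wellFounded_isChild : WellFounded C.IsChild := by
  have hirr : Std.Irrefl (Relation.TransGen C.IsChild) := ⟨fun v => C.acyclic v⟩
  have h : WellFounded (Relation.TransGen C.IsChild) :=
    Finite.wellFounded_of_trans_of_irrefl _
  exact Subrelation.wf (fun h => Relation.TransGen.single h) h

/-- One evaluation step: the value of `v` from the values of its children. -/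
def evalStep [Field F] (v : C.V) (val : ∀ u, C.IsChild u v → MvPolynomial ℕ F) :
    MvPolynomial ℕ F :=
  match hg : C.gate v with
  | .input l => l.toPoly
  | .add a b => val a (by simp [IsChild, hg, Gate.HasChild]) +
      val b (by simp [IsChild, hg, Gate.HasChild])
  | .mul a b => val a (by simp [IsChild, hg, Gate.HasChild]) *
      val b (by simp [IsChild, hg, Gate.HasChild])

/-- The polynomial computed at the gate `v`, by recursion along the acyclic child relation. -/
def value [Field F] (v : C.V) : MvPolynomial ℕ F :=
  C.wellFounded_isChild.fix C.evalStep v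

/-- The defining equations of `value`. -/
theorem value_eq [Field F] (v : C.V) :
    C.value v = match C.gate v with
      | .input l => l.toPoly
      | .add a b => C.value a + C.value b
      | .mul a b => C.value a * C.value b := by
  unfold value
  rw [WellFounded.fix_eq]
  unfold evalStep
  split <;> simp_all

/-- The polynomial computed by the circuit. -/
def poly [Field F] : MvPolynomial ℕ F := C.value C.out

end Circuit

/-! ### The class VP -/

/-- `a n` is bounded by a polynomial in `n`. -/
def PolyBounded (a : ℕ → ℕ) : Prop :=
  ∃ p : Polynomial ℕ, ∀ n, a n ≤ p.eval n

/-- `VP` over `F`: the families of polynomials that have polynomially bounded degree and are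
computed by families of arithmetic circuits of polynomial size. -/
def VP (F : Type*) [Field F] : Set (ℕ → MvPolynomial ℕ F) :=
  {f | PolyBounded (fun n => (f n).totalDegree) ∧
    ∃ C : ℕ → Circuit F, PolyBounded (fun n => (C n).size) ∧ ∀ n, (C n).poly = f n}

/-! ### Stack operations -/

/-- The stack operations on the symbol set `S`. -/
inductive StackOp (S : Type) where
  | push : S → StackOp S
  | pop : S → StackOp S
  | nop : StackOp S

/-- Realizable sequences of stack operations. -/
inductive Realizable {S : Type} : List (StackOp S) → Prop
  | nil : Realizable []
  | push_pop (s : S) {P : List (StackOp S)} :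
      Realizable P → Realizable (StackOp.push s :: (P ++ [StackOp.pop s]))
  | nop_left {P : List (StackOp S)} : Realizable P → Realizable (StackOp.nop :: P)
  | nop_right {P : List (StackOp S)} : Realizable P → Realizable (P ++ [StackOp.nop])
  | append {P Q : List (StackOp S)} : Realizable P → Realizable Q → Realizable (P ++ Q)

/-! ### Branching programs -/

/-- An arithmetic branching program: a finite directed acyclic graph with edge relation `E`, two
vertices `s`, `t`, and an edge labeling `w` (only its values on edges are ever used). -/
structure ABP (F : Type*) where
  V : Type
  [fintypeV : Fintype V]
  E : V → V → Prop
  acyclic : ∀ v, ¬ Relation.TransGen E v v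
  s : V
  t : V
  w : V → V → Label F

attribute [instance] ABP.fintypeV

namespace ABP

variable {F : Type*} (G : ABP F)

/-- The number of vertices. -/
def size : ℕ := Fintype.card G.V

/-- `G.IsPath u v P`: the list of vertices `P` is a path from `u` to `v` in `G`. The path with one
vertex and no edge is included. -/
def IsPath (u v : G.V) (P : List G.V) : Prop :=
  P.head? = some u ∧ P.getLast? = some v ∧ P.IsChain G.E ∧ P.Nodup

/-- The weight of a path: the product of the labels of its edges. -/
def weight [Field F] (P : List G.V) : MvPolynomial ℕ F :=
  (List.zipWith (fun a b => (G.w a b).toPoly) P P.tail).prod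

end ABP

/-- A stack branching program: an arithmetic branching program with a symbol set `S` and a
labeling `σ` of the edges by stack operations (only its values on edges are ever used). -/
structure SBP (F : Type*) extends ABP F where
  S : Type
  σ : V → V → StackOp S

namespace SBP

variable {F : Type*} (G : SBP F)

/-- The sequence of stack operations along a path. -/
def ops (P : List G.V) : List (StackOp G.S) :=
  List.zipWith G.σ P P.tail

theorem finite_realizablePaths :
    {P : List G.V | G.IsPath G.s G.t P ∧ Realizable (G.ops P)}.Finite := by
  have h : {P : List G.V | P.length ≤ Fintype.card G.V}.Finite :=
    List.finite_length_le G.V (Fintype.card G.V)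
  exact h.subset fun P hP => List.Nodup.length_le_card hP.1.2.2.2

/-- The finite set of all stack-realizable paths from `s` to `t`. -/
def realizablePaths : Finset (List G.V) := G.finite_realizablePaths.toFinset

/-- The polynomial computed by `G`: the sum of the weights of all stack-realizable paths from
`s` to `t`. -/
def poly [Field F] : MvPolynomial ℕ F :=
  ∑ P ∈ G.realizablePaths, G.weight P

end SBP

end

/-!
A stack branching program is analysed through its *path sums*: `SBP.pathSum t u st` is the sum of
the weights of the paths from `u` to `t` whose operations turn the stack `st` into the empty stack.
A sequence of operations is realizable exactly if it turns the empty stack into the empty stack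
(`StackOp.realizable_iff_run`), so the program computes `pathSum t s []`; and splitting off the
first edge of a path gives a recursion for the path sums (`SBP.pathSum_eq`).

*From programs to circuits.* Among the path sums, the polynomially many `pathSum v u []` suffice:
a realizable path that starts with a push splits uniquely at the matching pop, which expresses
`pathSum v u []` through at most `|V| + |V| ^ 3` products of edge labels and path sums that start
further down in the acyclic graph (`SBP.pathSum_cons`, `SBP.pathSum_nil`). Evaluating this
recursion from the sinks upwards is a straight-line program of polynomial length (`SLP`,
`SBP.exists_circuit`). The degree is at most the length of a path, hence at most the number of
vertices.

*From circuits to programs.* A circuit of size `s` for a polynomial of degree `d` may have gates of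
exponential degree, so gates are replaced by their homogeneous components of degree `k ≤ d`, where
components of degree `0` count as constants. A parse tree of such a component has at most
`2 * k * s + 1` nodes. The program traverses the parse trees depth first: at a product gate it
guesses how the degree splits, pushes the right factor and goes on with the left one; at a leaf it
reads the label and pops the next factor. The time is part of the vertex, which makes the graph
acyclic, and a final state with a loop of weight `1` lets short runs wait. As long as enough time is
left, the runs from a node with a given stack sum up to the product of the polynomials of the node
and of the entries of the stack (`Circuit.runSum_node`), by induction on the remaining time.
-/

noncomputable section

/-! ### Stack operations as partial functions on stacks -/

namespace StackOp

variable {S : Type}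

open Classical in
/-- The effect of a stack operation on a stack, whose top is the head of the list. The result is
`none` if the operation pops a symbol that is not on top. -/
def act : StackOp S → List S → Option (List S)
  | .push s, st => some (s :: st)
  | .pop _, [] => none
  | .pop s, c :: st => if c = s then some st else none
  | .nop, st => some st

/-- The effect of a sequence of stack operations on a stack. -/
def run : List (StackOp S) → List S → Option (List S)
  | [], st => some st
  | o :: P, st => (o.act st).bind (run P)

theorem run_append (P Q : List (StackOp S)) (st : List S) :
    run (P ++ Q) st = (run P st).bind (run Q) := by
  induction P generalizing st with
  | nil => simp [run]
  | cons o P ih =>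
    simp only [List.cons_append, run, Option.bind_assoc]
    congr 1
    funext st'
    exact ih st'

theorem run_of_realizable {P : List (StackOp S)} (hP : Realizable P) (st : List S) :
    run P st = some st := by
  induction hP generalizing st with
  | nil => rfl
  | push_pop s _ ih => simp [run, act, run_append, ih]
  | nop_left _ ih => simp [run, act, ih]
  | nop_right _ ih => simp [run, act, run_append, ih]
  | append _ _ ih₁ ih₂ => simp [run_append, ih₁, ih₂]

/-- `Empties st P`: the sequence `P` consists of realizable blocks separated by the operations that
pop the symbols of `st` one after the other. -/
def Empties : List S → List (StackOp S) → Prop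
  | [], P => Realizable P
  | c :: st, P => ∃ A B, P = A ++ StackOp.pop c :: B ∧ Realizable A ∧ Empties st B

theorem Empties.append_left {st : List S} {A P : List (StackOp S)} (hA : Realizable A)
    (h : Empties st P) : Empties st (A ++ P) := by
  cases st with
  | nil => exact Realizable.append hA h
  | cons c st =>
    obtain ⟨A', B, rfl, hA', hB⟩ := h
    exact ⟨A ++ A', B, by simp, hA.append hA', hB⟩

/-- Reading the sequence from the right end, every operation extends the block decomposition. -/
theorem empties_of_run {P : List (StackOp S)} {st : List S} (h : run P st = some []) :
    Empties st P := by
  induction P generalizing st with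
  | nil =>
    obtain rfl : st = [] := by simpa [run] using h
    exact Realizable.nil
  | cons o P ih =>
    cases o with
    | push s =>
      obtain ⟨A, B, rfl, hA, hB⟩ := ih (st := s :: st) (by simpa [run, act] using h)
      have := hB.append_left (Realizable.push_pop s hA)
      simpa using this
    | nop =>
      exact (ih (st := st) (by simpa [run, act] using h)).append_left
        (Realizable.nop_left Realizable.nil)
    | pop s =>
      cases st with
      | nil => simp [run, act] at h
      | cons c st =>
        by_cases hc : c = s
        · subst hc
          exact ⟨[], P, rfl, Realizable.nil, ih (by simpa [run, act] using h)⟩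
        · simp [run, act, hc] at h

theorem realizable_iff_run {P : List (StackOp S)} : Realizable P ↔ run P [] = some [] :=
  ⟨fun h => run_of_realizable h [], fun h => empties_of_run h⟩

end StackOp

/-! ### Path sums with an initial stack -/

/-- In an acyclic graph every walk is a path. -/
theorem ABP.nodup_of_isChain {F : Type*} (G : ABP F) {P : List G.V} (h : P.IsChain G.E) :
    P.Nodup := by
  have h' : P.IsChain (Relation.TransGen G.E) := h.imp fun _ _ => Relation.TransGen.single
  refine (List.isChain_iff_pairwise.mp h').imp ?_
  rintro a _ hab rfl
  exact G.acyclic a hab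

theorem ABP.isPath_cons_cons {F : Type*} (G : ABP F) {u t a x : G.V} {P : List G.V} :
    G.IsPath u t (a :: x :: P) ↔ a = u ∧ G.E a x ∧ G.IsPath x t (x :: P) := by
  constructor
  · rintro ⟨h₁, h₂, h₃, h₄⟩
    rw [List.isChain_cons_cons] at h₃
    exact ⟨by simpa using h₁, h₃.1, rfl, by simpa using h₂, h₃.2, h₄.of_cons⟩
  · rintro ⟨rfl, hE, -, h₂, h₃, -⟩
    have hc : (a :: x :: P).IsChain G.E := List.isChain_cons_cons.mpr ⟨hE, h₃⟩
    exact ⟨rfl, by simpa using h₂, hc, G.nodup_of_isChain hc⟩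

namespace SBP

variable {F : Type*} (G : SBP F)

theorem finite_emptyingPaths (t u : G.V) (st : List G.S) :
    {P : List G.V | G.IsPath u t P ∧ StackOp.run (G.ops P) st = some []}.Finite := by
  have h : {P : List G.V | P.length ≤ Fintype.card G.V}.Finite :=
    List.finite_length_le G.V (Fintype.card G.V)
  exact h.subset fun P hP => List.Nodup.length_le_card hP.1.2.2.2

/-- The paths from `u` to `t` whose stack operations turn the stack `st` into the empty stack. -/
def emptyingPaths (t u : G.V) (st : List G.S) : Finset (List G.V) :=
  (G.finite_emptyingPaths t u st).toFinset

/-- The sum of the weights of all paths from `u` to `t` whose stack operations turn the stack `st`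
into the empty stack. -/
def pathSum [Field F] (t u : G.V) (st : List G.S) : MvPolynomial ℕ F :=
  ∑ P ∈ G.emptyingPaths t u st, G.weight P

theorem mem_emptyingPaths {t u : G.V} {st : List G.S} {P : List G.V} :
    P ∈ G.emptyingPaths t u st ↔ G.IsPath u t P ∧ StackOp.run (G.ops P) st = some [] := by
  simp [emptyingPaths]

theorem poly_eq_pathSum [Field F] : G.poly = G.pathSum G.t G.s [] := by
  unfold poly pathSum
  congr 1
  ext P
  simp [realizablePaths, emptyingPaths, StackOp.realizable_iff_run]

open Classical in
/-- A path is a single vertex, or starts with an edge `(u, x)` that acts on the stack and goes on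
from `x` with the resulting stack. -/
theorem emptyingPaths_eq (t u : G.V) (st : List G.S) :
    G.emptyingPaths t u st = (if u = t ∧ st = [] then {[u]} else ∅) ∪
      Finset.univ.biUnion fun x => if G.E u x then
        ((G.σ u x).act st).elim ∅ fun st' => (G.emptyingPaths t x st').image (List.cons u)
        else ∅ := by
  ext P
  rw [mem_emptyingPaths, Finset.mem_union, Finset.mem_biUnion]
  match P with
  | [] =>
    have h : ¬ ∃ x ∈ (Finset.univ : Finset G.V), ([] : List G.V) ∈ (if G.E u x then
        ((G.σ u x).act st).elim ∅ fun st' => (G.emptyingPaths t x st').image (List.cons u)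
        else ∅) := by
      rintro ⟨x, -, hx⟩
      split_ifs at hx
      · cases hst : (G.σ u x).act st <;> simp [hst] at hx
      · simp at hx
    simp only [h, or_false]
    split_ifs <;> simp [ABP.IsPath]
  | [a] =>
    have h : ¬ ∃ x ∈ (Finset.univ : Finset G.V), [a] ∈ (if G.E u x then
        ((G.σ u x).act st).elim ∅ fun st' => (G.emptyingPaths t x st').image (List.cons u)
        else ∅) := by
      rintro ⟨x, -, hx⟩
      split_ifs at hx
      · cases hst : (G.σ u x).act st <;> simp [hst, mem_emptyingPaths, ABP.IsPath] at hx
      · simp at hx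
    simp only [h, or_false]
    by_cases hu : u = t ∧ st = []
    · simp only [ABP.IsPath, ops, hu]
      simp [StackOp.run]
    · simp only [ABP.IsPath, ops, hu]
      simp only [List.head?_cons, Option.some.injEq, List.getLast?_singleton, StackOp.run,
        List.tail_cons, List.zipWith_nil_right, if_false, Finset.notMem_empty, iff_false]
      rintro ⟨⟨rfl, rfl, -⟩, rfl⟩
      exact hu ⟨rfl, rfl⟩
  | a :: x :: P =>
    have h : a :: x :: P ∉ (if u = t ∧ st = [] then {[u]} else ∅ : Finset (List G.V)) := by
      split_ifs <;> simp
    simp only [h, false_or, Finset.mem_univ, true_and, ABP.isPath_cons_cons]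
    constructor
    · rintro ⟨⟨rfl, hE, hP⟩, hr⟩
      refine ⟨x, ?_⟩
      rw [if_pos hE]
      change ((G.σ a x).act st).bind (StackOp.run (G.ops (x :: P))) = _ at hr
      cases hst : (G.σ a x).act st with
      | none => simp [hst] at hr
      | some st' =>
        rw [hst] at hr
        exact Finset.mem_image_of_mem _ (G.mem_emptyingPaths.mpr ⟨hP, hr⟩)
    · rintro ⟨y, hy⟩
      split_ifs at hy with hE
      · cases hst : (G.σ u y).act st with
        | none => simp [hst] at hy
        | some st' =>
          simp only [hst, Option.elim_some, Finset.mem_image, List.cons.injEq] at hy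
          obtain ⟨Q, hQ, rfl, rfl⟩ := hy
          rw [mem_emptyingPaths] at hQ
          obtain rfl : x = y := by simpa using hQ.1.1
          refine ⟨⟨rfl, hE, hQ.1⟩, ?_⟩
          change ((G.σ u x).act st).bind (StackOp.run (G.ops (x :: P))) = _
          rw [hst]
          exact hQ.2
      · simp at hy

theorem weight_cons [Field F] {t u x : G.V} {st : List G.S} {P : List G.V}
    (hP : P ∈ G.emptyingPaths t x st) :
    G.weight (u :: P) = (G.w u x).toPoly * G.weight P := by
  rw [mem_emptyingPaths] at hP
  match P, hP with
  | [], hP => simp [ABP.IsPath] at hP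
  | y :: P, hP =>
    obtain rfl : y = x := by simpa using hP.1.1
    simp [ABP.weight]

open Classical in
/-- The path sums satisfy the recursion that splits off the first edge of a path. -/
theorem pathSum_eq [Field F] (t u : G.V) (st : List G.S) :
    G.pathSum t u st = (if u = t ∧ st = [] then 1 else 0) +
      ∑ x, if G.E u x then
        (G.w u x).toPoly * ((G.σ u x).act st).elim 0 (G.pathSum t x) else 0 := by
  have hhead : ∀ {x : G.V} {st' : List G.S} {P}, P ∈ G.emptyingPaths t x st' →
      P.head? = some x := fun h => (G.mem_emptyingPaths.mp h).1.1
  -- The second vertex of a path tells which term of the sum it belongs to.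
  have hmem : ∀ {x : G.V} {P : List G.V}, P ∈ (if G.E u x then
        ((G.σ u x).act st).elim ∅ fun st' => (G.emptyingPaths t x st').image (List.cons u)
        else ∅) → P.tail.head? = some x := by
    intro x P hP
    split_ifs at hP
    · cases hst : (G.σ u x).act st with
      | none => simp [hst] at hP
      | some st' =>
        simp only [hst, Option.elim_some, Finset.mem_image] at hP
        obtain ⟨Q, hQ, rfl⟩ := hP
        exact hhead hQ
    · simp at hP
  unfold pathSum
  rw [emptyingPaths_eq, Finset.sum_union, Finset.sum_biUnion]
  · congr 1
    · split_ifs <;> simp [ABP.weight]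
    · refine Finset.sum_congr rfl fun x _ => ?_
      split_ifs
      · cases hst : (G.σ u x).act st with
        | none => simp
        | some st' =>
          simp only [Option.elim_some]
          rw [Finset.sum_image (fun P _ Q _ h => List.tail_eq_of_cons_eq h), Finset.mul_sum]
          exact Finset.sum_congr rfl fun P hP => G.weight_cons hP
      · simp
  · intro x _ y _ hxy
    refine Finset.disjoint_left.mpr fun P hP hP' => hxy ?_
    exact Option.some.inj ((hmem hP).symm.trans (hmem hP'))
  · refine Finset.disjoint_left.mpr fun P hP hP' => ?_
    obtain ⟨x, -, hx⟩ := Finset.mem_biUnion.mp hP'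
    have := hmem hx
    split_ifs at hP
    · obtain rfl := Finset.mem_singleton.mp hP
      simp at this
    · simp at hP

end SBP

/-! ### Decomposition of path sums at the matching pop -/

namespace SBP

variable {F : Type*} (G : SBP F)

theorem wellFounded_flip_E : WellFounded (flip G.E) := by
  have hirr : Std.Irrefl (flip (Relation.TransGen G.E)) := ⟨fun v => G.acyclic v⟩
  have htr : IsTrans G.V (flip (Relation.TransGen G.E)) := ⟨fun _ _ _ h₁ h₂ => h₂.trans h₁⟩
  have h : WellFounded (flip (Relation.TransGen G.E)) :=
    Finite.wellFounded_of_trans_of_irrefl _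
  exact Subrelation.wf (r := flip (Relation.TransGen G.E))
    (fun h => Relation.TransGen.single h) h

theorem _root_.ABP.IsPath.reflTransGen {G : ABP F} {u t : G.V} {P : List G.V}
    (h : G.IsPath u t P) : Relation.ReflTransGen G.E u t := by
  induction P generalizing u with
  | nil => simp [ABP.IsPath] at h
  | cons a P ih =>
    cases P with
    | nil =>
      obtain rfl : a = u := by simpa using h.1
      obtain rfl : a = t := by simpa using h.2.1
      exact .refl
    | cons x P =>
      rw [ABP.isPath_cons_cons] at h
      obtain ⟨rfl, hE, hP⟩ := h
      exact .head hE (ih hP)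

theorem reflTransGen_of_pathSum_ne_zero [Field F] {t u : G.V} {st : List G.S}
    (h : G.pathSum t u st ≠ 0) : Relation.ReflTransGen G.E u t := by
  obtain ⟨P, hP, -⟩ := Finset.exists_ne_zero_of_sum_ne_zero h
  exact (G.mem_emptyingPaths.mp hP).1.reflTransGen

open Classical in
/-- The label of `(y, z)` if this is an edge that pops `c`, and `0` otherwise. -/
def popWeight [Field F] (c : G.S) (y z : G.V) : MvPolynomial ℕ F :=
  if G.E y z ∧ G.σ y z = .pop c then (G.w y z).toPoly else 0

open Classical in
/-- The label of `(u, x)` if this is an edge with operation `nop`, and `0` otherwise. -/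
def nopWeight [Field F] (u x : G.V) : MvPolynomial ℕ F :=
  if G.E u x ∧ G.σ u x = .nop then (G.w u x).toPoly else 0

open Classical in
/-- The product of the labels of `(u, x)` and `(y, z)` if these are edges that push and pop the same
symbol, and `0` otherwise. -/
def pushPopWeight [Field F] (u x y z : G.V) : MvPolynomial ℕ F :=
  if G.E u x ∧ G.E y z ∧ ∃ c, G.σ u x = .push c ∧ G.σ y z = .pop c then
    (G.w u x).toPoly * (G.w y z).toPoly else 0

/-- A path that empties the stack `c :: st` splits uniquely at the edge `(y, z)` that pops `c`: the
part before it is realizable, and the part after it empties `st`. -/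
theorem pathSum_cons [Field F] (t u : G.V) (c : G.S) (st : List G.S) :
    G.pathSum t u (c :: st) =
      ∑ y, ∑ z, G.pathSum y u [] * G.popWeight c y z * G.pathSum t z st := by
  classical
  -- Induction on `u` from the sinks upwards; the claim is needed at all vertices reachable from `u`.
  suffices h : ∀ u' t c st, Relation.ReflTransGen G.E u u' → G.pathSum t u' (c :: st) =
      ∑ y, ∑ z, G.pathSum y u' [] * G.popWeight c y z * G.pathSum t z st from h u t c st .refl
  induction u using G.wellFounded_flip_E.induction with
  | _ u ih =>
    intro u' t c st hu'
    rcases hu'.cases_head with rfl | ⟨x, hux, hx⟩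
    swap
    · exact ih x hux u' t c st hx
    have hR : ∀ y, G.pathSum y u [] * (∑ z, G.popWeight c y z * G.pathSum t z st) =
        (if u = y then 1 else 0) * (∑ z, G.popWeight c y z * G.pathSum t z st) +
        ∑ x, if G.E u x then (G.w u x).toPoly * (((G.σ u x).act []).elim 0 (G.pathSum y x) *
          (∑ z, G.popWeight c y z * G.pathSum t z st)) else 0 := by
      intro y
      rw [pathSum_eq, add_mul, Finset.sum_mul]
      simp only [and_true, ite_mul, zero_mul, mul_assoc]
    simp only [mul_assoc, ← Finset.mul_sum]
    rw [pathSum_eq, Finset.sum_congr rfl fun y _ => hR y, Finset.sum_add_distrib,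
      Finset.sum_comm (s := Finset.univ (α := G.V))]
    simp only [ite_mul, one_mul, zero_mul, Finset.sum_ite_eq, Finset.mem_univ, if_true]
    rw [← Finset.sum_add_distrib]
    simp only [reduceCtorEq, and_false, if_false, zero_add]
    refine Finset.sum_congr rfl fun x _ => ?_
    by_cases hE : G.E u x
    swap
    · simp [hE, popWeight]
    simp only [hE, if_true, ← Finset.mul_sum]
    cases hσ : G.σ u x with
    | nop =>
      simp only [StackOp.act, Option.elim_some, popWeight, hσ, reduceCtorEq, and_false, if_false,
        zero_mul, zero_add]
      rw [ih x hE x t c st .refl]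
      simp only [mul_assoc, ← Finset.mul_sum, popWeight]
    | pop s =>
      by_cases hc : c = s
      · simp [StackOp.act, popWeight, hσ, hc, hE]
      · simp [StackOp.act, popWeight, hσ, hc, Ne.symm hc]
    | push b =>
      have h₀ : G.popWeight c u x = 0 := by simp [popWeight, hσ]
      simp only [StackOp.act, Option.elim_some, h₀, zero_mul, zero_add]
      congr 1
      rw [ih x hE x t b (c :: st) .refl]
      have h₁ : ∀ y z, G.pathSum y x [] * G.popWeight b y z * G.pathSum t z (c :: st) =
          G.pathSum y x [] * G.popWeight b y z *
            ∑ y', ∑ z', G.pathSum y' z [] * G.popWeight c y' z' * G.pathSum t z' st := by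
        intro y z
        -- A nonzero factor makes `z` reachable from `x`, so that the induction hypothesis applies.
        by_cases hy : G.pathSum y x [] = 0
        · simp [hy]
        by_cases hz : G.E y z
        · rw [ih x hE z t c st ((G.reflTransGen_of_pathSum_ne_zero hy).tail hz)]
        · simp [popWeight, hz]
      simp only [h₁]
      -- The induction hypothesis holds for every target, in particular for `y'`.
      have h₂ : ∀ y', G.pathSum y' x [b] =
          ∑ y, ∑ z, G.pathSum y x [] * G.popWeight b y z * G.pathSum y' z [] :=
        fun y' => ih x hE x y' b [] .refl
      have h₃ : ∀ z, ∑ y', ∑ z', G.pathSum y' z [] * G.popWeight c y' z' * G.pathSum t z' st =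
          ∑ y', G.pathSum y' z [] * ∑ z', G.popWeight c y' z' * G.pathSum t z' st := fun z => by
        simp only [mul_assoc, ← Finset.mul_sum]
      have h₄ : ∀ (a : G.V → G.V → MvPolynomial ℕ F) (K : G.V → MvPolynomial ℕ F),
          ∑ y, ∑ z, a y z * ∑ y', G.pathSum y' z [] * K y' =
            ∑ y', (∑ y, ∑ z, a y z * G.pathSum y' z []) * K y' := by
        intro a K
        simp only [Finset.sum_mul, Finset.mul_sum, mul_assoc]
        symm
        rw [Finset.sum_comm]
        exact Finset.sum_congr rfl fun y _ => Finset.sum_comm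
      simp only [h₃, h₂]
      exact h₄ _ _

open Classical in
/-- The recursion of the realizable path sums: a nonempty realizable path starts with a `nop`
edge, or with a push edge `(u, x)`, whose matching pop is at a later edge `(y, z)`. -/
theorem pathSum_nil [Field F] (u v : G.V) :
    G.pathSum v u [] = (if u = v then MvPolynomial.C 1 else MvPolynomial.C 0) +
      ((∑ x, G.nopWeight u x * G.pathSum v x []) +
       ∑ p : G.V × G.V × G.V, G.pushPopWeight u p.1 p.2.1 p.2.2 * G.pathSum p.2.1 p.1 [] *
        G.pathSum v p.2.2 []) := by
  classical
  rw [pathSum_eq]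
  congr 1
  · simp
  simp only [Fintype.sum_prod_type]
  rw [← Finset.sum_add_distrib]
  refine Finset.sum_congr rfl fun x _ => ?_
  by_cases hE : G.E u x
  swap
  · simp [hE, nopWeight, pushPopWeight]
  simp only [hE, if_true]
  cases hσ : G.σ u x with
  | nop => simp [StackOp.act, nopWeight, pushPopWeight, hσ, hE]
  | pop s => simp [StackOp.act, nopWeight, pushPopWeight, hσ]
  | push b =>
    simp only [StackOp.act, Option.elim_some]
    rw [pathSum_cons, Finset.mul_sum]
    simp only [nopWeight, hσ, reduceCtorEq, and_false, if_false, zero_mul, zero_add]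
    refine Finset.sum_congr rfl fun y _ => ?_
    rw [Finset.mul_sum]
    refine Finset.sum_congr rfl fun z _ => ?_
    simp only [pushPopWeight, popWeight, hσ, hE, true_and, StackOp.push.injEq, exists_eq_left']
    split_ifs <;> ring

theorem totalDegree_weight_le [Field F] (P : List G.V) :
    (G.weight P).totalDegree ≤ P.length := by
  induction P with
  | nil => simp [ABP.weight]
  | cons a P ih =>
    cases P with
    | nil => simp [ABP.weight]
    | cons b P =>
      have h : G.weight (a :: b :: P) = (G.w a b).toPoly * G.weight (b :: P) := by
        simp [ABP.weight]
      have hl : (G.w a b).toPoly.totalDegree ≤ 1 := by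
        cases G.w a b <;> simp [Label.toPoly]
      rw [h, List.length_cons]
      exact (MvPolynomial.totalDegree_mul _ _).trans (by omega)

theorem totalDegree_poly_le [Field F] : G.poly.totalDegree ≤ G.size := by
  refine MvPolynomial.totalDegree_finsetSum_le fun P hP => ?_
  have hP' : G.IsPath G.s G.t P ∧ Realizable (G.ops P) := by simpa [realizablePaths] using hP
  exact (G.totalDegree_weight_le P).trans (List.Nodup.length_le_card hP'.1.2.2.2)

end SBP

/-! ### Straight-line programs -/

/-- The value of a gate, given the values of all vertices. -/
def Gate.eval {F : Type*} [Field F] {V : Type} (val : V → MvPolynomial ℕ F) :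
    Gate F V → MvPolynomial ℕ F
  | .input l => l.toPoly
  | .add a b => val a + val b
  | .mul a b => val a * val b

/-- Relabelling of the children of a gate. -/
def Gate.map {F : Type*} {V W : Type} (φ : V → W) : Gate F V → Gate F W
  | .input l => .input l
  | .add a b => .add (φ a) (φ b)
  | .mul a b => .mul (φ a) (φ b)

theorem Gate.hasChild_map {F : Type*} {V W : Type} {φ : V → W} {g : Gate F V} {x : W} :
    (g.map φ).HasChild x ↔ ∃ u, g.HasChild u ∧ φ u = x := by
  cases g <;> simp [Gate.map, Gate.HasChild, eq_comm]

theorem Gate.eval_map {F : Type*} [Field F] {V W : Type} (φ : V → W)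
    (val : W → MvPolynomial ℕ F) (g : Gate F V) : (g.map φ).eval val = g.eval (val ∘ φ) := by
  cases g <;> rfl

theorem Gate.exists_map_val {F : Type*} {V : Type} {p : V → Prop} (g : Gate F V)
    (h : ∀ u, g.HasChild u → p u) : ∃ g' : Gate F {v // p v}, g'.map Subtype.val = g := by
  cases g with
  | input l => exact ⟨.input l, rfl⟩
  | add a b => exact ⟨.add ⟨a, h a (.inl rfl)⟩ ⟨b, h b (.inr rfl)⟩, rfl⟩
  | mul a b => exact ⟨.mul ⟨a, h a (.inl rfl)⟩ ⟨b, h b (.inr rfl)⟩, rfl⟩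

/-- A straight-line program, given by the list of the polynomials it computes, the last one
first: every entry is a label, or the sum or the product of two later entries of the list. -/
inductive SLP {F : Type*} [Field F] : List (MvPolynomial ℕ F) → Prop
  | nil : SLP []
  | input (l : Label F) {L : List (MvPolynomial ℕ F)} : SLP L → SLP (l.toPoly :: L)
  | add {p q : MvPolynomial ℕ F} {L : List (MvPolynomial ℕ F)} :
      SLP L → p ∈ L → q ∈ L → SLP ((p + q) :: L)
  | mul {p q : MvPolynomial ℕ F} {L : List (MvPolynomial ℕ F)} :
      SLP L → p ∈ L → q ∈ L → SLP ((p * q) :: L)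

namespace SLP

variable {F : Type*} [Field F]

/-- Entry `i` is the value of a gate whose children are entries further down the list. -/
theorem exists_gate {L : List (MvPolynomial ℕ F)} (hL : SLP L) (i : Fin L.length) :
    ∃ g : Gate F (Fin L.length), (∀ j, g.HasChild j → i < j) ∧ g.eval L.get = L.get i := by
  -- A gate for a shorter list stays a gate for the same entry after an entry is put in front.
  have hsucc : ∀ (p : MvPolynomial ℕ F) (L : List (MvPolynomial ℕ F)) (i : Fin L.length)
      (g : Gate F (Fin L.length)), (∀ j, g.HasChild j → i < j) → g.eval L.get = L.get i →
      ∃ g : Gate F (Fin (p :: L).length), (∀ j, g.HasChild j → Fin.succ i < j) ∧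
        g.eval (p :: L).get = (p :: L).get (Fin.succ i) := by
    intro p L i g hg hv
    refine ⟨g.map Fin.succ, ?_, ?_⟩
    · intro j hj
      obtain ⟨u, hu, rfl⟩ := Gate.hasChild_map.mp hj
      exact Fin.succ_lt_succ_iff.mpr (hg u hu)
    · rw [Gate.eval_map]
      exact hv
  induction hL with
  | nil => exact i.elim0
  | input l hL ih =>
    cases i using Fin.cases with
    | zero => exact ⟨.input l, fun j hj => hj.elim, rfl⟩
    | succ i =>
      obtain ⟨g, hg, hv⟩ := ih i
      exact hsucc _ _ i g hg hv
  | add hL hp hq ih =>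
    cases i using Fin.cases with
    | zero =>
      obtain ⟨a, rfl⟩ := List.get_of_mem hp
      obtain ⟨b, rfl⟩ := List.get_of_mem hq
      refine ⟨.add a.succ b.succ, ?_, rfl⟩
      rintro j (rfl | rfl) <;> exact Fin.succ_pos _
    | succ i =>
      obtain ⟨g, hg, hv⟩ := ih i
      exact hsucc _ _ i g hg hv
  | mul hL hp hq ih =>
    cases i using Fin.cases with
    | zero =>
      obtain ⟨a, rfl⟩ := List.get_of_mem hp
      obtain ⟨b, rfl⟩ := List.get_of_mem hq
      refine ⟨.mul a.succ b.succ, ?_, rfl⟩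
      rintro j (rfl | rfl) <;> exact Fin.succ_pos _
    | succ i =>
      obtain ⟨g, hg, hv⟩ := ih i
      exact hsucc _ _ i g hg hv

/-- Every polynomial of a straight-line program is computed by a circuit of at most the same size.
The gates from which the output gate cannot be reached are dropped, so that the output gate is the
only sink. -/
theorem exists_circuit {L : List (MvPolynomial ℕ F)} (hL : SLP L) {p : MvPolynomial ℕ F}
    (hp : p ∈ L) : ∃ C : Circuit F, C.size ≤ L.length ∧ C.poly = p := by
  classical
  obtain ⟨o, rfl⟩ := List.get_of_mem hp
  choose gate hlt hval using hL.exists_gate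
  let R : Fin L.length → Fin L.length → Prop := fun u v => (gate v).HasChild u
  let p : Fin L.length → Prop := fun v => Relation.ReflTransGen R v o
  have hgate : ∀ v : {v // p v}, ∃ g : Gate F {v // p v}, g.map Subtype.val = gate v :=
    fun v => Gate.exists_map_val _ fun u hu => Relation.ReflTransGen.head hu v.2
  choose gate' hgate' using hgate
  have hchild : ∀ u v : {v // p v}, (gate' v).HasChild u ↔ (gate v).HasChild u := by
    intro u v
    rw [← hgate', Gate.hasChild_map]
    simp only [Subtype.val_inj, exists_eq_right]
  have htrans : ∀ u v : {v // p v},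
      Relation.TransGen (fun u v => (gate' v).HasChild u) u v → v < u := by
    intro u v h
    induction h with
    | single h => exact hlt _ _ ((hchild _ _).mp h)
    | tail _ h ih => exact (hlt _ _ ((hchild _ _).mp h) : _).trans ih
  let C : Circuit F :=
    { V := {v // p v}
      gate := gate'
      acyclic := fun v h => lt_irrefl _ (htrans v v h)
      out := ⟨o, .refl⟩
      isSink_iff := by
        intro v
        constructor
        · intro hv
          rcases v.2.cases_head with h | ⟨u, hu, huo⟩
          · exact Subtype.ext h
          · exact (hv ⟨⟨u, huo⟩, (hchild _ _).mpr hu⟩).elim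
        · rintro rfl ⟨u, hu⟩
          have h₁ : u.1 < o := hlt _ _ ((hchild _ _).mp hu)
          have h₂ : ∀ w, Relation.ReflTransGen R w o → o ≤ w := by
            intro w hw
            induction hw using Relation.ReflTransGen.head_induction_on with
            | refl => exact le_rfl
            | head h _ ih => exact ih.trans (hlt _ _ h).le
          exact absurd h₁ (h₂ u u.2).not_gt }
  have hC : ∀ v : C.V, C.value v = L.get v.1 := by
    intro v
    induction v using C.wellFounded_isChild.induction with
    | _ v ih =>
      have h : C.value v = (C.gate v).eval C.value := by
        rw [C.value_eq]
        cases C.gate v <;> rfl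
      have hev : (C.gate v).eval C.value = (C.gate v).eval (L.get ∘ Subtype.val) := by
        have ih' : ∀ u, (C.gate v).HasChild u → C.value u = L.get u.1 := ih
        cases hg : C.gate v with
        | input l => rfl
        | add a b =>
          rw [hg] at ih'
          simp only [Gate.eval, Function.comp, ih' a (.inl rfl), ih' b (.inr rfl)]
        | mul a b =>
          rw [hg] at ih'
          simp only [Gate.eval, Function.comp, ih' a (.inl rfl), ih' b (.inr rfl)]
      rw [h, hev, ← Gate.eval_map]
      change ((gate' v).map Subtype.val).eval L.get = _
      rw [hgate', hval]
  refine ⟨C, ?_, hC _⟩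
  calc Fintype.card {v // p v} ≤ Fintype.card (Fin L.length) := Fintype.card_subtype_le p
    _ = L.length := Fintype.card_fin _

/-- `SLP.Gen B A k`: every straight-line program that computes the polynomials in `B` can be
extended by at most `k` steps to one that also computes the polynomials in `A`. -/
def Gen (B A : Set (MvPolynomial ℕ F)) (k : ℕ) : Prop :=
  ∀ L, SLP L → (∀ p ∈ B, p ∈ L) → ∃ L', SLP L' ∧ (∀ p ∈ L, p ∈ L') ∧ (∀ p ∈ A, p ∈ L') ∧
    L'.length ≤ L.length + k

namespace Gen

variable {B B' A A' : Set (MvPolynomial ℕ F)} {k k' : ℕ}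

theorem of_subset (h : A ⊆ B) : Gen B A 0 :=
  fun L hL hB => ⟨L, hL, fun _ => id, fun p hp => hB p (h hp), le_rfl⟩

theorem mono (h : Gen B A k) (hB : B ⊆ B') (hA : A' ⊆ A) (hk : k ≤ k') : Gen B' A' k' := by
  intro L hL hL'
  obtain ⟨L', h₁, h₂, h₃, h₄⟩ := h L hL fun p hp => hL' p (hB hp)
  exact ⟨L', h₁, h₂, fun p hp => h₃ p (hA hp), by omega⟩

theorem trans (h : Gen B A k) (h' : Gen (B ∪ A) A' k') : Gen B (A ∪ A') (k + k') := by
  intro L hL hB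
  obtain ⟨L₁, h₁, h₂, h₃, h₄⟩ := h L hL hB
  obtain ⟨L₂, h₁', h₂', h₃', h₄'⟩ := h' L₁ h₁ <| by
    rintro p (hp | hp)
    · exact h₂ p (hB p hp)
    · exact h₃ p hp
  refine ⟨L₂, h₁', fun p hp => h₂' p (h₂ p hp), ?_, by omega⟩
  rintro p (hp | hp)
  · exact h₂' p (h₃ p hp)
  · exact h₃' p hp

theorem union (h : Gen B A k) (h' : Gen B A' k') : Gen B (A ∪ A') (k + k') :=
  h.trans (h'.mono Set.subset_union_left le_rfl le_rfl)

theorem label (l : Label F) : Gen B {l.toPoly} 1 := by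
  intro L hL _
  exact ⟨_, hL.input l, fun p hp => List.mem_cons_of_mem _ hp, by simp, by simp⟩

theorem add {p q : MvPolynomial ℕ F} (hp : Gen B {p} k) (hq : Gen B {q} k') :
    Gen B {p + q} (k + k' + 1) := by
  intro L hL hB
  obtain ⟨L₁, h₁, h₂, h₃, h₄⟩ := hp.union hq L hL hB
  exact ⟨_, h₁.add (h₃ p (.inl rfl)) (h₃ q (.inr rfl)),
    fun r hr => List.mem_cons_of_mem _ (h₂ r hr), by simp, by simp only [List.length_cons]; omega⟩

theorem mul {p q : MvPolynomial ℕ F} (hp : Gen B {p} k) (hq : Gen B {q} k') :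
    Gen B {p * q} (k + k' + 1) := by
  intro L hL hB
  obtain ⟨L₁, h₁, h₂, h₃, h₄⟩ := hp.union hq L hL hB
  exact ⟨_, h₁.mul (h₃ p (.inl rfl)) (h₃ q (.inr rfl)),
    fun r hr => List.mem_cons_of_mem _ (h₂ r hr), by simp, by simp only [List.length_cons]; omega⟩

theorem of_mem {p : MvPolynomial ℕ F} (hp : p ∈ B) : Gen B {p} 0 :=
  of_subset (Set.singleton_subset_iff.mpr hp)

theorem zero : Gen B {0} 1 := by
  simpa [Label.toPoly] using label (B := B) (Label.const 0)

theorem biUnion {ι : Type*} (s : Finset ι) {A : ι → Set (MvPolynomial ℕ F)}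
    (h : ∀ i ∈ s, Gen B (A i) k) : Gen B (⋃ i ∈ s, A i) (s.card * k) := by
  classical
  induction s using Finset.induction_on with
  | empty => exact (of_subset (Set.empty_subset B)).mono le_rfl (by simp) (by simp)
  | insert i s hi ih =>
    refine ((h i (Finset.mem_insert_self i s)).union
      (ih fun j hj => h j (Finset.mem_insert_of_mem hj))).mono le_rfl (by simp) ?_
    rw [Finset.card_insert_of_notMem hi]
    exact le_of_eq (by ring)

theorem sum {ι : Type*} (s : Finset ι) {g : ι → MvPolynomial ℕ F}
    (h : ∀ i ∈ s, Gen B {g i} k) : Gen B {∑ i ∈ s, g i} (s.card * (k + 1) + 1) := by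
  classical
  induction s using Finset.induction_on with
  | empty => simpa using zero
  | insert i s hi ih =>
    rw [Finset.sum_insert hi]
    refine ((h i (Finset.mem_insert_self i s)).add
      (ih fun j hj => h j (Finset.mem_insert_of_mem hj))).mono le_rfl le_rfl ?_
    rw [Finset.card_insert_of_notMem hi]
    exact le_of_eq (by ring)

end Gen

end SLP

/-! ### From stack branching programs to circuits -/

namespace SBP

variable {F : Type*} [Field F] (G : SBP F)

/-- The labels of all pairs of vertices. -/
def labelPolys : Set (MvPolynomial ℕ F) := Set.range fun e : G.V × G.V => (G.w e.1 e.2).toPoly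

/-- The realizable path sums from the vertices in `S`. -/
def pathSumsFrom (S : Finset G.V) : Set (MvPolynomial ℕ F) :=
  {p | ∃ u ∈ S, ∃ v, p = G.pathSum v u []}

/-- One path sum can be computed from the edge labels and the path sums that start further down. -/
theorem gen_pathSum {S : Finset G.V} (hS : ∀ u ∈ S, ∀ x, G.E u x → x ∈ S) {u : G.V}
    (hu : ∀ x, G.E u x → x ∈ S) (v : G.V) :
    SLP.Gen (G.labelPolys ∪ G.pathSumsFrom S) {G.pathSum v u []}
      (4 * G.size ^ 3 + 2 * G.size + 5) := by
  classical
  have hw : ∀ a b, (G.w a b).toPoly ∈ G.labelPolys ∪ G.pathSumsFrom S :=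
    fun a b => .inl ⟨(a, b), rfl⟩
  have hR : ∀ x ∈ S, ∀ y, G.pathSum y x [] ∈ G.labelPolys ∪ G.pathSumsFrom S :=
    fun x hx y => .inr ⟨x, hx, y, rfl⟩
  have hS' : ∀ x ∈ S, ∀ y, Relation.ReflTransGen G.E x y → y ∈ S := by
    intro x hx y h
    induction h with
    | refl => exact hx
    | tail _ h ih => exact hS _ ih _ h
  have h₁ : SLP.Gen (G.labelPolys ∪ G.pathSumsFrom S)
      {if u = v then MvPolynomial.C 1 else MvPolynomial.C 0} 1 := by
    split_ifs
    exacts [.label (.const 1), .label (.const 0)]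
  have h₂ : ∀ x, SLP.Gen (G.labelPolys ∪ G.pathSumsFrom S)
      {G.nopWeight u x * G.pathSum v x []} 1 := by
    intro x
    unfold nopWeight
    split_ifs with h
    · exact (SLP.Gen.of_mem (hw u x)).mul (.of_mem (hR x (hu x h.1) v))
    · rw [zero_mul]
      exact .zero
  have h₃ : ∀ p : G.V × G.V × G.V, SLP.Gen (G.labelPolys ∪ G.pathSumsFrom S)
      {G.pushPopWeight u p.1 p.2.1 p.2.2 * G.pathSum p.2.1 p.1 [] * G.pathSum v p.2.2 []} 3 := by
    rintro ⟨x, y, z⟩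
    unfold pushPopWeight
    split_ifs with h
    · have hx := hu x h.1
      -- If `y` cannot be reached from `x`, then `z` may lie outside `S`, but the term vanishes.
      by_cases h0 : G.pathSum y x [] = 0
      · simp only [h0, mul_zero, zero_mul]
        exact SLP.Gen.zero.mono le_rfl le_rfl (by omega)
      · have hz := hS y (hS' x hx y (G.reflTransGen_of_pathSum_ne_zero h0)) z h.2.1
        exact (((SLP.Gen.of_mem (hw u x)).mul (.of_mem (hw y z))).mul
          (.of_mem (hR x hx y))).mul (.of_mem (hR z hz v))
    · simp only [zero_mul]
      exact SLP.Gen.zero.mono le_rfl le_rfl (by omega)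
  rw [pathSum_nil]
  refine (h₁.add ((SLP.Gen.sum _ fun x _ => h₂ x).add (SLP.Gen.sum _ fun p _ => h₃ p))).mono
    le_rfl le_rfl ?_
  simp only [Finset.card_univ, Fintype.card_prod, ABP.size]
  exact le_of_eq (by ring)

/-- The path sums from a set of vertices that is closed under successors can be computed from the edge
labels in polynomially many steps per vertex. -/
theorem gen_pathSumsFrom (S : Finset G.V) (hS : ∀ u ∈ S, ∀ x, G.E u x → x ∈ S) :
    SLP.Gen G.labelPolys (G.pathSumsFrom S)
      (S.card * (G.size * (4 * G.size ^ 3 + 2 * G.size + 5))) := by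
  classical
  induction hn : S.card generalizing S with
  | zero =>
    obtain rfl := Finset.card_eq_zero.mp hn
    exact (SLP.Gen.of_subset (Set.empty_subset _)).mono le_rfl
      (by rintro p ⟨u, hu, -⟩; simp at hu) (by simp)
  | succ n ih =>
    -- A vertex of `S` without predecessors in `S` is processed last.
    have hwf : WellFounded G.E := by
      have hirr : Std.Irrefl (Relation.TransGen G.E) := ⟨fun v => G.acyclic v⟩
      exact Subrelation.wf (fun h => Relation.TransGen.single h)
        (Finite.wellFounded_of_trans_of_irrefl (Relation.TransGen G.E))
    obtain ⟨u, hu, hmin⟩ := hwf.has_min (S : Set G.V)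
      (Finset.card_pos.mp (by omega : 0 < S.card))
    have hS₁ : ∀ y ∈ S.erase u, ∀ x, G.E y x → x ∈ S.erase u := by
      intro y hy x hyx
      rw [Finset.mem_erase] at hy ⊢
      refine ⟨?_, hS y hy.2 x hyx⟩
      rintro rfl
      exact hmin y hy.2 hyx
    have hu₁ : ∀ x, G.E u x → x ∈ S.erase u := by
      intro x hux
      rw [Finset.mem_erase]
      refine ⟨?_, hS u hu x hux⟩
      rintro rfl
      exact hmin x hu hux
    have hc : (S.erase u).card = n := by
      rw [Finset.card_erase_of_mem hu, hn, Nat.add_sub_cancel]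
    refine ((ih _ hS₁ hc).trans (SLP.Gen.biUnion Finset.univ
      fun v _ => G.gen_pathSum hS₁ hu₁ v)).mono le_rfl ?_ ?_
    · rintro p ⟨x, hx, v, rfl⟩
      by_cases hxu : x = u
      · subst hxu
        exact .inr (by simp)
      · exact .inl ⟨x, Finset.mem_erase.mpr ⟨hxu, hx⟩, v, rfl⟩
    · simp only [Finset.card_univ]
      exact le_of_eq (by simp only [ABP.size]; ring)

theorem exists_circuit : ∃ C : Circuit F,
    C.size ≤ G.size ^ 2 + G.size * (G.size * (4 * G.size ^ 3 + 2 * G.size + 5)) ∧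
      C.poly = G.poly := by
  classical
  have h₁ : SLP.Gen ∅ G.labelPolys (G.size ^ 2) := by
    refine (SLP.Gen.biUnion (Finset.univ : Finset (G.V × G.V))
      fun e _ => SLP.Gen.label (G.w e.1 e.2)).mono le_rfl ?_ ?_
    · rintro _ ⟨e, rfl⟩
      simp only [Finset.mem_univ, Set.iUnion_true, Set.mem_iUnion, Set.mem_singleton_iff]
      exact ⟨e, rfl⟩
    · simp only [Finset.card_univ, Fintype.card_prod, ABP.size]
      exact le_of_eq (by ring)
  obtain ⟨L, hL, -, hA, hk⟩ := h₁.trans ((G.gen_pathSumsFrom Finset.univ (by simp)).mono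
    Set.subset_union_right le_rfl le_rfl) [] SLP.nil (by simp)
  obtain ⟨C, hC, hp⟩ := hL.exists_circuit (hA _ (.inr ⟨G.s, by simp, G.t, rfl⟩))
  refine ⟨C, hC.trans (hk.trans ?_), hp.trans G.poly_eq_pathSum.symm⟩
  simp [ABP.size]

end SBP

/-! ### Layered stack branching programs -/

section Layered

variable {F : Type*} {X S : Type}

/-- The stack branching program that runs for exactly `T` steps on the state set `X`: its vertices
are pairs of a time and a state, and every edge increases the time by one. The entry `step x y` holds
the label and the stack operation of the edges from `x` to `y`. -/
def layeredSBP [Fintype X] (T : ℕ) (step : X → X → Label F × StackOp S) (start done : X) :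
    SBP F where
  V := Fin (T + 1) × X
  E p q := q.1.1 = p.1.1 + 1
  acyclic := by
    have h : ∀ p q : Fin (T + 1) × X,
        Relation.TransGen (fun p q : Fin (T + 1) × X => q.1.1 = p.1.1 + 1) p q →
          p.1.1 < q.1.1 := by
      intro p q hpq
      induction hpq with
      | single h => omega
      | tail _ h ih => omega
    exact fun v hv => lt_irrefl _ (h v v hv)
  s := (0, start)
  t := (Fin.last T, done)
  w p q := (step p.2 q.2).1
  S := S
  σ p q := (step p.2 q.2).2

theorem size_layeredSBP [Fintype X] (T : ℕ) (step : X → X → Label F × StackOp S) (start done : X) :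
    (layeredSBP T step start done).size = (T + 1) * Fintype.card X := by
  exact (Fintype.card_prod (Fin (T + 1)) X).trans (by rw [Fintype.card_fin])

open Classical in
/-- The sum of the weights of all sequences of `n` steps that lead from the state `x` to the state
`done` and turn the stack `st` into the empty stack. -/
def runSum [Field F] [Fintype X] (step : X → X → Label F × StackOp S) (done : X) :
    ℕ → X → List S → MvPolynomial ℕ F
  | 0, x, st => if x = done ∧ st = [] then 1 else 0
  | n + 1, x, st => ∑ y, (step x y).1.toPoly * ((step x y).2.act st).elim 0 (runSum step done n y)

variable [Field F] [Fintype X] (T : ℕ) (step : X → X → Label F × StackOp S) (start done : X)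

theorem pathSum_layeredSBP (n : ℕ) (τ : Fin (T + 1)) (h : τ.1 + n = T) (x : X) (st : List S) :
    (layeredSBP T step start done).pathSum (Fin.last T, done) (τ, x) st =
      runSum step done n x st := by
  classical
  let D : Fin (T + 1) × X → List S → MvPolynomial ℕ F :=
    (layeredSBP T step start done).pathSum (Fin.last T, done)
  have hD : ∀ τ x st, D (τ, x) st = (if (τ, x) = (Fin.last T, done) ∧ st = [] then 1 else 0) +
      ∑ q : Fin (T + 1) × X, if q.1.1 = τ.1 + 1 then
        (step x q.2).1.toPoly * ((step x q.2).2.act st).elim 0 (D q) else 0 := by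
    intro τ x st
    refine (SBP.pathSum_eq (layeredSBP T step start done) _ _ _).trans ?_
    exact congrArg₂ (· + ·) (by congr!)
      (Finset.sum_congr rfl fun q _ => if_congr Iff.rfl rfl rfl)
  change D (τ, x) st = _
  clear_value D
  induction n generalizing τ x st with
  | zero =>
    obtain rfl : τ = Fin.last T := Fin.ext (by simpa using h)
    have h0 : ∀ i : Fin (T + 1), i.1 ≠ T + 1 := fun i => by omega
    rw [hD, Finset.sum_eq_zero fun q _ => if_neg (h0 q.1), add_zero, runSum]
    exact if_congr (by simp) rfl rfl
  | succ n ih =>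
    have hτ : τ ≠ Fin.last T := fun hτ => by simp [hτ] at h
    rw [hD, Fintype.sum_prod_type, Finset.sum_eq_single (⟨τ.1 + 1, by omega⟩ : Fin (T + 1))]
    · simp only [Prod.mk.injEq, hτ, false_and, if_false, if_true, zero_add, runSum]
      refine Finset.sum_congr rfl fun y _ => ?_
      congr 2
      funext st'
      exact ih ⟨τ.1 + 1, by omega⟩ (by simp only; omega) y st'
    · intro i _ hi
      exact Finset.sum_eq_zero fun y _ => if_neg fun hE => hi (Fin.ext hE)
    · simp

theorem poly_layeredSBP : (layeredSBP T step start done).poly = runSum step done T start [] := by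
  rw [SBP.poly_eq_pathSum]
  exact pathSum_layeredSBP T step start done T 0 (by simp) start []

end Layered

/-! ### Homogeneous components of products -/

theorem MvPolynomial.homogeneousComponent_mul_eq_sum {σ R : Type*} [CommSemiring R] (k : ℕ)
    (f g : MvPolynomial σ R) :
    homogeneousComponent k (f * g) = ∑ p ∈ Finset.HasAntidiagonal.antidiagonal k,
      homogeneousComponent p.1 f * homogeneousComponent p.2 g := by
  classical
  ext e
  simp only [coeff_sum, coeff_homogeneousComponent, coeff_mul]
  rw [Finset.sum_comm]
  have hdeg : ∀ q ∈ Finset.HasAntidiagonal.antidiagonal e,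
      Finsupp.degree q.1 + Finsupp.degree q.2 = Finsupp.degree e := fun q hq => by
    rw [← map_add, Finset.HasAntidiagonal.mem_antidiagonal.mp hq]
  split_ifs with hk
  · refine Finset.sum_congr rfl fun q hq => ?_
    rw [Finset.sum_eq_single (Finsupp.degree q.1, Finsupp.degree q.2)]
    · simp
    · rintro ⟨i, j⟩ - hij
      by_cases hi : Finsupp.degree q.1 = i
      · by_cases hj : Finsupp.degree q.2 = j
        · exact (hij (by rw [hi, hj])).elim
        · simp [hj]
      · simp [hi]
    · intro hq'
      exact (hq' (Finset.HasAntidiagonal.mem_antidiagonal.mpr ((hdeg q hq).trans hk))).elim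
  · refine (Finset.sum_eq_zero fun q hq => Finset.sum_eq_zero ?_).symm
    rintro ⟨i, j⟩ hij
    rw [Finset.HasAntidiagonal.mem_antidiagonal] at hij
    by_cases hi : Finsupp.degree q.1 = i
    · by_cases hj : Finsupp.degree q.2 = j
      · exact (hk (by rw [← hdeg q hq, hi, hj, hij])).elim
      · simp [hj]
    · simp [hi]

theorem MvPolynomial.homogeneousComponent_mul_eq_sum_fin {σ R : Type*} [CommSemiring R] {d : ℕ}
    (k : Fin (d + 1)) (f g : MvPolynomial σ R) :
    homogeneousComponent k.1 (f * g) = ∑ j : Fin (d + 1), if j ≤ k then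
      homogeneousComponent j.1 f * homogeneousComponent (k.1 - j.1) g else 0 := by
  rw [homogeneousComponent_mul_eq_sum, Finset.Nat.sum_antidiagonal_eq_sum_range_succ
    (fun i j => homogeneousComponent i f * homogeneousComponent j g)]
  simp only [Fin.le_def]
  rw [Fin.sum_univ_eq_sum_range (fun j => if j ≤ k.1 then
      homogeneousComponent j f * homogeneousComponent (k.1 - j) g else 0), ← Finset.sum_filter]
  refine Finset.sum_congr ?_ fun _ _ => rfl
  ext j
  simp only [Finset.mem_range, Finset.mem_filter]
  omega

/-! ### From circuits to stack branching programs -/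

namespace Circuit

variable {F : Type*} (C : Circuit F)

open Classical in
/-- The number of gates strictly below `v`. -/
def rank (v : C.V) : ℕ := (Finset.univ.filter fun u => Relation.TransGen C.IsChild u v).card

theorem rank_lt_of_isChild {u v : C.V} (h : C.IsChild u v) : C.rank u < C.rank v := by
  classical
  refine Finset.card_lt_card (Finset.ssubset_iff_subset_ne.mpr ⟨fun x hx => ?_, fun he => ?_⟩)
  · simp only [Finset.mem_filter, Finset.mem_univ, true_and] at hx ⊢
    exact hx.tail h
  · have hu : u ∈ Finset.univ.filter fun x => Relation.TransGen C.IsChild x v := by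
      simpa using Relation.TransGen.single h
    rw [← he] at hu
    exact C.acyclic u (Finset.mem_filter.mp hu).2

theorem rank_lt_size (v : C.V) : C.rank v < C.size := by
  classical
  refine Finset.card_lt_univ_of_notMem (x := v) ?_
  exact fun h => C.acyclic v (Finset.mem_filter.mp h).2

variable [Field F] (d : ℕ)

/-- The label whose polynomial is the degree `k` component of the gate `v`, if `k = 0` or `v` is an
input gate. -/
def leafLabel (v : C.V) (k : ℕ) : Label F :=
  if k = 0 then .const (MvPolynomial.coeff 0 (C.value v)) else
    match C.gate v with
    | .input (.var i) => if k = 1 then .var i else .const 0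
    | _ => .const 0

theorem toPoly_leafLabel_zero (v : C.V) :
    (C.leafLabel v 0).toPoly = MvPolynomial.homogeneousComponent 0 (C.value v) := by
  simp [leafLabel, Label.toPoly]

theorem toPoly_leafLabel_input {v : C.V} {l : Label F} (h : C.gate v = .input l) (k : ℕ) :
    (C.leafLabel v k).toPoly = MvPolynomial.homogeneousComponent k (C.value v) := by
  rcases eq_or_ne k 0 with rfl | hk
  · exact C.toPoly_leafLabel_zero v
  · rw [C.value_eq, h]
    simp only [leafLabel, hk, if_false, h]
    cases l with
    | const c =>
      rw [MvPolynomial.homogeneousComponent_eq_zero _ _ (by simp [Label.toPoly]; omega)]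
      simp [Label.toPoly]
    | var i =>
      have hX := MvPolynomial.homogeneousComponent_of_mem (m := k)
        (MvPolynomial.isHomogeneous_X F i)
      simp only [Label.toPoly, hX]
      split_ifs <;> simp

/-- The nodes of the simulation: the pair `(v, k)` stands for the homogeneous component of degree
`k` of the gate `v`. -/
abbrev Node : Type := C.V × Fin (d + 1)

/-- The states of the simulation: a start state `inl false`, a final state `inl true`, and the
nodes. -/
abbrev State : Type := Bool ⊕ C.Node d

/-- The steps from a node at which a parse tree ends: the label of the node is read, and the run
continues at the node on top of the stack, or in the final state. -/
def leafStep (l : Label F) : C.State d → Label F × StackOp (C.Node d)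
  | .inl false => (.const 0, .nop)
  | .inl true => (l, .nop)
  | .inr z => (l, .pop z)

open Classical in
/-- The steps from a node: a run guesses a parse tree of the node in depth-first order and keeps
the pending right factors on the stack. Components of degree `0` are constants and are read off at
once. At an addition gate, the two summands may coincide, in which case the only edge to them has
label `2`. -/
def nodeStep (x : C.Node d) : C.State d → Label F × StackOp (C.Node d) :=
  if x.2 = 0 then C.leafStep d (C.leafLabel x.1 x.2) else
    match C.gate x.1 with
    | .input _ => C.leafStep d (C.leafLabel x.1 x.2)
    | .add a b => fun
      | .inl _ => (.const 0, .nop)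
      | .inr z => (.const (if z.2 = x.2 then (if z.1 = a then 1 else 0) +
          (if z.1 = b then 1 else 0) else 0), .nop)
    | .mul a b => fun
      | .inl _ => (.const 0, .nop)
      | .inr z => (.const (if z.1 = a ∧ z.2 ≤ x.2 then 1 else 0),
          .push (b, ⟨x.2.1 - z.2.1, by omega⟩))

open Classical in
/-- The steps of the simulation. From the start state, the run guesses the degree of a homogeneous
component of the output gate. -/
def simStep : C.State d → C.State d → Label F × StackOp (C.Node d)
  | .inl false, .inl _ => (.const 0, .nop)
  | .inl false, .inr z => (.const (if z.1 = C.out then 1 else 0), .nop)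
  | .inl true, y => (.const (if y = .inl true then 1 else 0), .nop)
  | .inr x, y => C.nodeStep d x y

/-- The polynomial that a node stands for. -/
def component (x : C.Node d) : MvPolynomial ℕ F :=
  MvPolynomial.homogeneousComponent x.2.1 (C.value x.1)

/-- A bound for the size of the parse trees of a node. At a product gate the costs of the factors and
the gate itself add up to at most this value, since the rank drops by `1` and `k ≥ 1`: the summand `1`
of the second factor and the `1` for the gate are paid for by `2 * k`. -/
def cost (x : C.Node d) : ℕ := 2 * x.2.1 * C.rank x.1 + 1

/-- In the final state a run can only wait, so pending stack symbols are never popped. -/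
theorem runSum_done (n : ℕ) (st : List (C.Node d)) :
    runSum (C.simStep d) (.inl true) n (.inl true) st = if st = [] then 1 else 0 := by
  classical
  induction n generalizing st with
  | zero => simp [runSum]
  | succ n ih =>
    rw [runSum, Finset.sum_eq_single (.inl true)]
    · simp [simStep, StackOp.act, Label.toPoly, ih]
    · intro y _ hy
      simp [simStep, Label.toPoly, hy]
    · simp

theorem sum_leafStep (l : Label F) (n : ℕ) (st : List (C.Node d)) :
    ∑ y, (C.leafStep d l y).1.toPoly * ((C.leafStep d l y).2.act st).elim 0
        (runSum (C.simStep d) (.inl true) n y) =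
      l.toPoly * match st with
        | [] => 1
        | z :: st => runSum (C.simStep d) (.inl true) n (.inr z) st := by
  classical
  rw [Fintype.sum_sum_type, Fintype.sum_bool]
  cases st with
  | nil => simp [leafStep, StackOp.act, Label.toPoly, runSum_done]
  | cons z st =>
    simp only [leafStep, StackOp.act, Option.elim_some, runSum_done, reduceCtorEq, if_false,
      mul_zero, Label.toPoly, map_zero, zero_mul, zero_add]
    rw [Finset.sum_eq_single z]
    · simp
    · intro y _ hy
      simp [Ne.symm hy]
    · simp

/-- If enough time is left, the runs from a node multiply the polynomial of the node with those of
the nodes on the stack. -/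
theorem runSum_node (n : ℕ) (x : C.Node d) (st : List (C.Node d))
    (h : C.cost d x + (st.map (C.cost d)).sum ≤ n) :
    runSum (C.simStep d) (.inl true) n (.inr x) st =
      C.component d x * (st.map (C.component d)).prod := by
  classical
  induction n generalizing x st with
  | zero => simp [cost] at h
  | succ n ih =>
    obtain ⟨v, k⟩ := x
    have hleaf : (C.leafLabel v k.1).toPoly = C.component d (v, k) →
        ∑ y, (C.leafStep d (C.leafLabel v k.1) y).1.toPoly *
          ((C.leafStep d (C.leafLabel v k.1) y).2.act st).elim 0
            (runSum (C.simStep d) (.inl true) n y) =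
          C.component d (v, k) * (st.map (C.component d)).prod := by
      intro hl
      rw [sum_leafStep, hl]
      cases st with
      | nil => simp
      | cons z st =>
        simp only [List.map_cons, List.sum_cons, List.prod_cons] at h ⊢
        rw [ih z st (by simp only [cost] at h ⊢; omega)]
    rw [runSum]
    simp only [simStep, nodeStep]
    by_cases hk : k = 0
    · subst hk
      simp only [if_true]
      exact hleaf (C.toPoly_leafLabel_zero v)
    have hk' : 1 ≤ k.1 := Nat.one_le_iff_ne_zero.mpr fun h => hk (Fin.ext h)
    simp only [hk, if_false]
    have hval := C.value_eq v
    cases hg : C.gate v with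
    | input l => exact hleaf (C.toPoly_leafLabel_input hg k.1)
    | add a b =>
      rw [hg] at hval
      have hca : C.rank a + 1 ≤ C.rank v :=
        C.rank_lt_of_isChild (by simp [IsChild, hg, Gate.HasChild])
      have hcb : C.rank b + 1 ≤ C.rank v :=
        C.rank_lt_of_isChild (by simp [IsChild, hg, Gate.HasChild])
      have ha := Nat.mul_le_mul_left (2 * k.1) hca
      have hb := Nat.mul_le_mul_left (2 * k.1) hcb
      rw [mul_add] at ha hb
      simp only [cost] at h
      have ha' := ih (a, k) st (by simp only [cost]; omega)
      have hb' := ih (b, k) st (by simp only [cost]; omega)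
      rw [Fintype.sum_sum_type, Fintype.sum_bool, Fintype.sum_prod_type]
      simp only [Label.toPoly, map_zero, zero_mul, zero_add, StackOp.act, Option.elim_some,
        apply_ite (MvPolynomial.C (R := F) (σ := ℕ)), map_add, map_one, ite_mul,
        Finset.sum_ite_eq', Finset.mem_univ, if_true, add_mul, one_mul, Finset.sum_add_distrib]
      rw [ha', hb', component, component, component, hval, map_add, add_mul]
    | mul a b =>
      rw [hg] at hval
      have hca : C.rank a + 1 ≤ C.rank v :=
        C.rank_lt_of_isChild (by simp [IsChild, hg, Gate.HasChild])
      have hcb : C.rank b + 1 ≤ C.rank v :=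
        C.rank_lt_of_isChild (by simp [IsChild, hg, Gate.HasChild])
      rw [Fintype.sum_sum_type, Fintype.sum_bool, Fintype.sum_prod_type]
      simp only [Label.toPoly, map_zero, zero_mul, zero_add, StackOp.act, Option.elim_some,
        apply_ite (MvPolynomial.C (R := F) (σ := ℕ)), map_one, ite_mul, one_mul, ite_and]
      rw [Finset.sum_comm]
      simp only [Finset.sum_ite_eq', Finset.mem_univ, if_true]
      rw [component, hval, MvPolynomial.homogeneousComponent_mul_eq_sum_fin, Finset.sum_mul]
      refine Finset.sum_congr rfl fun j _ => ?_
      split_ifs with hj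
      · rw [ih]
        · simp [component, mul_assoc]
        · have ha := Nat.mul_le_mul_left (2 * j.1) hca
          have hb := Nat.mul_le_mul_left (2 * (k.1 - j.1)) hcb
          have hjk : 2 * j.1 * C.rank v + 2 * (k.1 - j.1) * C.rank v = 2 * k.1 * C.rank v := by
            rw [← add_mul, ← mul_add, Nat.add_sub_cancel' hj]
          have hj' : j.1 ≤ k.1 := hj
          rw [mul_add] at ha hb
          simp only [cost, List.map_cons, List.sum_cons] at h ⊢
          omega
      · simp

theorem exists_sbp (hd : C.poly.totalDegree ≤ d) : ∃ G : SBP F,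
    G.size = (2 * d * C.size + 3) * (C.size * (d + 1) + 2) ∧ G.poly = C.poly := by
  classical
  refine ⟨layeredSBP (2 * d * C.size + 2) (C.simStep d) (.inl false) (.inl true), ?_, ?_⟩
  · rw [size_layeredSBP]
    simp only [Fintype.card_sum, Fintype.card_bool, Fintype.card_prod, Fintype.card_fin, size]
    ring
  · have hrank : ∀ k : Fin (d + 1), C.cost d (C.out, k) ≤ 2 * d * C.size + 1 := by
      intro k
      have := Nat.mul_le_mul (Nat.mul_le_mul_left 2 (Nat.lt_succ_iff.mp k.2))
        (C.rank_lt_size C.out).le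
      simp only [cost]
      omega
    rw [poly_layeredSBP, runSum, Fintype.sum_sum_type, Fintype.sum_bool, Fintype.sum_prod_type]
    simp only [simStep, Label.toPoly, map_zero, zero_mul, zero_add, StackOp.act, Option.elim_some,
        apply_ite (MvPolynomial.C (R := F) (σ := ℕ)), map_one, ite_mul, one_mul]
    rw [Finset.sum_comm]
    simp only [Finset.sum_ite_eq', Finset.mem_univ, if_true]
    rw [Finset.sum_congr rfl fun k _ => C.runSum_node d (2 * d * C.size + 1) (C.out, k) []
      (by simpa using hrank k)]
    simp only [List.map_nil, List.prod_nil, mul_one, component]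
    rw [Fin.sum_univ_eq_sum_range (fun k => MvPolynomial.homogeneousComponent k (C.value C.out)),
      ← Finset.sum_subset (Finset.range_mono (Nat.succ_le_succ hd))]
    · exact MvPolynomial.sum_homogeneousComponent (C.value C.out)
    · intro k _ hk
      exact MvPolynomial.homogeneousComponent_eq_zero _ _ 
        (show C.poly.totalDegree < k by simpa [Nat.succ_le_iff] using hk)

end Circuit

/-! ### Polynomial bounds -/

theorem PolyBounded.mono {a b : ℕ → ℕ} (hb : PolyBounded b) (h : ∀ n, a n ≤ b n) :
    PolyBounded a := by
  obtain ⟨p, hp⟩ := hb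
  exact ⟨p, fun n => (h n).trans (hp n)⟩

theorem PolyBounded.const (c : ℕ) : PolyBounded fun _ => c := ⟨Polynomial.C c, by simp⟩

theorem PolyBounded.add {a b : ℕ → ℕ} (ha : PolyBounded a) (hb : PolyBounded b) :
    PolyBounded fun n => a n + b n := by
  obtain ⟨p, hp⟩ := ha
  obtain ⟨q, hq⟩ := hb
  exact ⟨p + q, fun n => by simpa using Nat.add_le_add (hp n) (hq n)⟩

theorem PolyBounded.mul {a b : ℕ → ℕ} (ha : PolyBounded a) (hb : PolyBounded b) :
    PolyBounded fun n => a n * b n := by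
  obtain ⟨p, hp⟩ := ha
  obtain ⟨q, hq⟩ := hb
  exact ⟨p * q, fun n => by simpa using Nat.mul_le_mul (hp n) (hq n)⟩

theorem PolyBounded.pow {a : ℕ → ℕ} (ha : PolyBounded a) (k : ℕ) :
    PolyBounded fun n => a n ^ k := by
  obtain ⟨p, hp⟩ := ha
  exact ⟨p ^ k, fun n => by simpa using Nat.pow_le_pow_left (hp n) k⟩

end

/-! ### The equivalence -/

theorem mainTheorem1 {F : Type*} [Field F] (f : ℕ → MvPolynomial ℕ F) :
    f ∈ VP F ↔
      ∃ G : ℕ → SBP F, PolyBounded (fun n => (G n).size) ∧ ∀ n, (G n).poly = f n := by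
  constructor
  · rintro ⟨hdeg, C, hsize, hC⟩
    choose G hG hGC using fun n => (C n).exists_sbp (f n).totalDegree (by rw [hC n])
    refine ⟨G, ?_, fun n => (hGC n).trans (hC n)⟩
    simp only [hG]
    exact ((((PolyBounded.const 2).mul hdeg).mul hsize).add (.const 3)).mul
      ((hsize.mul (hdeg.add (.const 1))).add (.const 2))
  · rintro ⟨G, hsize, hG⟩
    refine ⟨hsize.mono fun n => ?_, ?_⟩
    · rw [← hG n]
      exact (G n).totalDegree_poly_le
    · choose C hC hCG using fun n => (G n).exists_circuit
      refine ⟨C, PolyBounded.mono ?_ hC, fun n => (hCG n).trans (hG n)⟩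
      exact (hsize.pow 2).add (hsize.mul (hsize.mul
        ((((PolyBounded.const 4).mul (hsize.pow 3)).add ((PolyBounded.const 2).mul hsize)).add
          (.const 5))))
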